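/- Let $(P,d,\mu)$ be a metric space with a Borel regular measure $\mu$ such that every open ball has finite positive measure. Assume that $\mu$ is doubling ($\mu(B(x,2r))\le c\,\mu(B(x,r))$ for all $x\in P$, $r>0$, with a constant $c\ge 1$) and non-atomic (every measurable set of positive measure has a measurable subset of strictly smaller positive measure). All functions below are $\mu$-measurable and extended real-valued, and all sets are $\mu$-measurable. Let $X$ be a rearrangement-invariant Banach function space over $(P,\mu)$, i.e. $X=\{u:\|u\|_X<\infty\}$, where $\|\cdot\|_X$ assigns to each measurable function a value in $[0,\infty]$ such that for all measurable $u,v,u_n$: $\|u\|_X=0$ iff $u=0$ a.e.; $\|au\|_X=|a|\,\|u\|_X$ for $a\in\mathbb R$; $\|u+v\|_X\le\|u\|_X+\|v\|_X$; $|u|\le|v|$ a.e. implies $\|u\|_X\le\|v\|_X$; $0\le u_n\uparrow u$ a.e. implies $\|u_n\|_X\uparrow\|u\|_X$; $\|\chi_E\|_X<\infty$ whenever $\mu(E)<\infty$; for each $E$ with $\mu(E)<\infty$ there is $C_E>0$ with $\int_E|u|\,d\mu\le C_E\|u\|_X$ for every $u$; and $\|u\|_X=\|v\|_X$ whenever $\mu(\{|u|>t\})=\mu(\{|v|>t\})$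 for all $t\ge0$. Its fundamental function is $\phi(t)=\|\chi_{E_t}\|_X$ for $0\le t<\mu(P)$, where $E_t$ is any measurable set with $\mu(E_t)=t$, and $\phi(t)=\|1\|_X$ for $t\ge\mu(P)$, $t<\infty$. Let $u^*(t)=\inf\{s\ge0:\mu(\{|u|>s\})\le t\}$ be the decreasing rearrangement of $u$, and let $M^*(X)$ be the weak Marcinkiewicz space of all $u$ with $\|u\|_{M^*(X)}=\sup_{t>0}u^*(t)\phi(t)<\infty$. Write $v\in M^*(X)_{\mathrm{fm}}$ if $v\chi_E\in M^*(X)$ for every $E$ with $\mu(E)<\infty$. For $p\in[1,\infty)$ let $$M_pu(x)=\sup_{B\ni x}\Bigl(\frac1{\mu(B)}\int_B|u|^p\,d\mu\Bigr)^{1/p},$$ the supremum being taken over all open balls $B$ containing $x$. The operator $M_p\colon M^*(X)\to M^*(X)_{\mathrm{fm}}$ is called bounded if it maps $M^*(X)$ into $M^*(X)_{\mathrm{fm}}$ and for every $E\subset P$ with $\mu(E)<\infty$ there is $c_E>0$ such that $\|(M_pu)\chi_E\|_{M^*(X)}\le c_E\|u\|_{M^*(X)}$ for all $u\in M^*(X)$.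 Then, for every $p\in[1,\infty)$, the operator $M_p\colon M^*(X)\to M^*(X)_{\mathrm{fm}}$ is bounded if and only if $$\sup_{0<t<1}\ \phi(t)^p\,\frac1t\int_0^t\frac{ds}{\phi(s)^p}<\infty .$$ -/

import Mathlib

open MeasureTheory Filter Topology Set
open scoped ENNReal NNReal

/-- `u` belongs to the space `X` determined by the functional `N`: it is a `μ`-measurable extended
real-valued function (measurability refers to the completion of `μ`) and `N u` is finite. -/
def MemSpace {P : Type*} [MeasurableSpace P] (μ : Measure P) (N : (P → EReal) → ℝ≥0∞)
    (u : P → EReal) : Prop :=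
  AEMeasurable u μ ∧ N u < ∞

/-- `u ∈ X_fm`: the restrictions of `u` to sets of finite measure belong to `X`. -/
def MemSpaceFm {P : Type*} [MeasurableSpace P] (μ : Measure P) (N : (P → EReal) → ℝ≥0∞)
    (u : P → EReal) : Prop :=
  AEMeasurable u μ ∧
    ∀ E : Set P, NullMeasurableSet E μ → μ E < ∞ → MemSpace μ N (E.indicator u)

/-- Distribution function `μ_f(s) = μ {x : |f x| > s}`. -/
noncomputable def distribFun {P : Type*} [MeasurableSpace P] (μ : Measure P) (f : P → EReal)
    (s : ℝ≥0∞) : ℝ≥0∞ :=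
  μ {x | s < (f x).abs}

/-- Decreasing rearrangement `f^*(t) = inf {s ≥ 0 : μ_f(s) ≤ t}`, with values in `[0, ∞]`
(letting `s = ∞` in the set only encodes the convention `inf ∅ = ∞`). -/
noncomputable def decRearr {P : Type*} [MeasurableSpace P] (μ : Measure P) (f : P → EReal)
    (t : ℝ) : ℝ≥0∞ :=
  sInf {s : ℝ≥0∞ | distribFun μ f s ≤ ENNReal.ofReal t}

/-- Rearrangement-invariant Banach function spaces over `(P, μ)`. The space is
`X = {u : MemSpace μ N u}`, and `N u`, defined for every measurable `u`, is the norm of `u`. -/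
structure IsRISpace {P : Type*} [MeasurableSpace P] (μ : Measure P)
    (N : (P → EReal) → ℝ≥0∞) : Prop where
  eq_zero_iff : ∀ u : P → EReal, AEMeasurable u μ → (N u = 0 ↔ ∀ᵐ x ∂μ, u x = 0)
  smul : ∀ (a : ℝ) (u : P → EReal), AEMeasurable u μ →
    N (fun x => (a : EReal) * u x) = ENNReal.ofReal |a| * N u
  add_le : ∀ u v : P → EReal, AEMeasurable u μ → AEMeasurable v μ →
    N (fun x => u x + v x) ≤ N u + N v
  lattice : ∀ u v : P → EReal, AEMeasurable u μ → AEMeasurable v μ →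
    (∀ᵐ x ∂μ, (u x).abs ≤ (v x).abs) → N u ≤ N v
  fatou : ∀ (u : ℕ → P → EReal) (v : P → EReal), (∀ n, AEMeasurable (u n) μ) →
    AEMeasurable v μ → (∀ᵐ x ∂μ, ∀ n, 0 ≤ u n x) → (∀ᵐ x ∂μ, Monotone fun n => u n x) →
    (∀ᵐ x ∂μ, Tendsto (fun n => u n x) atTop (𝓝 (v x))) →
    Tendsto (fun n => N (u n)) atTop (𝓝 (N v))
  indicator_lt_top : ∀ E : Set P, NullMeasurableSet E μ → μ E < ∞ →
    N (E.indicator fun _ => 1) < ∞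
  locL1 : ∀ E : Set P, NullMeasurableSet E μ → μ E < ∞ →
    ∃ C : ℝ≥0, 0 < C ∧ ∀ u : P → EReal, AEMeasurable u μ →
      ∫⁻ x in E, (u x).abs ∂μ ≤ C * N u
  rearr_inv : ∀ u v : P → EReal, AEMeasurable u μ → AEMeasurable v μ →
    (∀ t : ℝ≥0, distribFun μ u t = distribFun μ v t) → N u = N v

open scoped Classical in
/-- Fundamental function: `φ(t) = N χ_E` for any measurable `E` with `μ E = t` if `t < μ(P)`, and
`φ(t) = N 1` if `t ≥ μ(P)`. In a rearrangement-invariant space all such `E` give the same value, so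
the supremum over `E` is that common value. -/
noncomputable def fundFun {P : Type*} [MeasurableSpace P] (μ : Measure P)
    (N : (P → EReal) → ℝ≥0∞) (t : ℝ) : ℝ≥0∞ :=
  if ENNReal.ofReal t < μ univ then
    ⨆ (E : Set P) (_ : NullMeasurableSet E μ ∧ μ E = ENNReal.ofReal t), N (E.indicator fun _ => 1)
  else N fun _ => 1

/-- The quasi-norm `sup_{t > 0} u^*(t) φ(t)` of the weak Marcinkiewicz space `M^*_φ`. -/
noncomputable def weakMarcinkiewicz {P : Type*} [MeasurableSpace P] (μ : Measure P)
    (φ : ℝ → ℝ≥0∞) (u : P → EReal) : ℝ≥0∞ :=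
  ⨆ (t : ℝ) (_ : 0 < t), decRearr μ u t * φ t

/-- The quasi-norm of `M^*(X)`, where `X` has the norm `N`. -/
noncomputable def weakNorm {P : Type*} [MeasurableSpace P] (μ : Measure P)
    (N : (P → EReal) → ℝ≥0∞) : (P → EReal) → ℝ≥0∞ :=
  weakMarcinkiewicz μ (fundFun μ N)

/-- The non-centered maximal operator `M_p`; the supremum is over all open balls containing `x`. -/
noncomputable def maximalOp {P : Type*} [MetricSpace P] [MeasurableSpace P] (μ : Measure P)
    (p : ℝ) (u : P → EReal) (x : P) : EReal :=
  ((⨆ (y : P) (r : ℝ) (_ : 0 < r ∧ x ∈ Metric.ball y r),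
    (⨍⁻ z in Metric.ball y r, (u z).abs ^ p ∂μ) ^ (1 / p) : ℝ≥0∞) : EReal)

/-- Boundedness of a map `T : X → Y_fm`, where `X` and `Y` have the (quasi-)norms `NX`, `NY`. -/
def IsBoundedFm {P : Type*} [MeasurableSpace P] (μ : Measure P)
    (NX NY : (P → EReal) → ℝ≥0∞) (T : (P → EReal) → P → EReal) : Prop :=
  (∀ u, MemSpace μ NX u → MemSpaceFm μ NY (T u)) ∧
    ∀ E : Set P, NullMeasurableSet E μ → μ E < ∞ →
      ∃ c : ℝ≥0, 0 < c ∧ ∀ u, MemSpace μ NX u → NY (E.indicator (T u)) ≤ c * NX u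

/-- Doubling: `μ(2B) ≤ c μ(B)` for every ball `B`. -/
def IsDoublingMeasure {P : Type*} [MetricSpace P] [MeasurableSpace P] (μ : Measure P) : Prop :=
  ∃ c : ℝ≥0, 1 ≤ c ∧ ∀ (x : P) (r : ℝ), 0 < r →
    μ (Metric.ball x (2 * r)) ≤ c * μ (Metric.ball x r)

/-- Non-atomic measure: every measurable set of positive measure has a measurable subset of
strictly smaller positive measure. -/
def IsNonatomicMeasure {P : Type*} [MeasurableSpace P] (μ : Measure P) : Prop :=
  ∀ A : Set P, MeasurableSet A → 0 < μ A →
    ∃ B : Set P, B ⊆ A ∧ MeasurableSet B ∧ 0 < μ B ∧ μ B < μ A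

/-!
Fix a rearrangement-invariant `X` with fundamental function `φ`. Only three facts about `φ` matter:
it is increasing, positive on `(0, ∞)` and finite. They follow from non-atomicity of `μ`, which
provides nested sets of all admissible measures.

*Sufficiency.* Splitting `|u|^p` at the height `u^*(t)^p` and applying the weak type `(1, 1)` bound
for the maximal function to the upper part gives Herz's estimate
`(M_p u)^*(t)^p ≤ C (1/t) ∫_0^t u^*(s)^p ds`. Since `u^* ≤ ‖u‖ / φ`, the integral condition bounds
`(M_p u)^* φ` on `(0, 1)`. For `t ≥ 1` one compares with `t = 1/2`, because the rearrangement of a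
function supported in `E` vanishes beyond `μ E`.

*Necessity.* Choose balls `B k` of radius `2^{-k}` about one point. The function `w` that equals
`1 / φ(μ(B k))` on `B k \ B (k + 1)` lies in the unit ball of `M^*(X)`. By doubling,
`∫_0^{μ(B k)} φ^{-p}` is at most a constant times `∫_{B k} w^p`, and `M_p w` is at least the
`p`-mean of `w` over `B k` on all of `B k`. Testing boundedness on `w` with `E = B 0` therefore
gives the integral condition near `0`, which is all that is needed.
-/

section Separability

theorem countable_of_pairwiseDisjoint_isOpen {X ι : Type*} [TopologicalSpace X]
    [MeasurableSpace X] [OpensMeasurableSpace X] (μ : Measure X) [SFinite μ]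
    [μ.IsOpenPosMeasure] {u : Set ι} {U : ι → Set X} (hopen : ∀ i ∈ u, IsOpen (U i))
    (hne : ∀ i ∈ u, (U i).Nonempty) (hdisj : u.PairwiseDisjoint U) : u.Countable := by
  have hcount := Measure.countable_meas_pos_of_disjoint_iUnion (μ := μ)
    (fun i : u => (hopen i i.2).measurableSet)
    fun i j hij => hdisj i.2 j.2 (Subtype.coe_ne_coe.2 hij)
  exact countable_coe_iff.1 (countable_univ_iff.1 (hcount.mono fun i _ =>
    (hopen i i.2).measure_pos μ (hne i i.2)))

theorem secondCountableTopology_of_isOpenPosMeasure {X : Type*} [PseudoMetricSpace X]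
    [MeasurableSpace X] [OpensMeasurableSpace X] (μ : Measure X) [SFinite μ]
    [μ.IsOpenPosMeasure] : SecondCountableTopology X := by
  refine Metric.secondCountable_of_almost_dense_set fun ε hε => ?_
  obtain ⟨u, -, hdisj, hcover⟩ := Vitali.exists_disjoint_subfamily_covering_enlargement_ball
    (univ : Set X) id (fun _ => ε / 4) (ε / 4) (fun _ _ => le_rfl) 4 (by norm_num)
  refine ⟨u, countable_of_pairwiseDisjoint_isOpen μ (fun _ _ => Metric.isOpen_ball)
    (fun _ _ => Metric.nonempty_ball.2 (by positivity)) hdisj, fun x => ?_⟩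
  obtain ⟨y, hy, hsub⟩ := hcover x (mem_univ x)
  have hxy : dist x y < 4 * (ε / 4) := hsub (Metric.mem_ball_self (by positivity))
  exact ⟨y, hy, by linarith⟩

theorem isOpenPosMeasure_of_measure_ball_pos {X : Type*} [PseudoMetricSpace X]
    [MeasurableSpace X] {μ : Measure X} (hpos : ∀ x r, 0 < r → 0 < μ (Metric.ball x r)) :
    μ.IsOpenPosMeasure := by
  refine ⟨fun U hU ⟨x, hx⟩ => ?_⟩
  obtain ⟨r, hr, hsub⟩ := Metric.isOpen_iff.1 hU x hx
  exact ((hpos x r hr).trans_le (measure_mono hsub)).ne'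

theorem sigmaFinite_of_measure_ball_lt_top {X : Type*} [PseudoMetricSpace X] [MeasurableSpace X]
    {μ : Measure X} (hfin : ∀ x r, 0 < r → μ (Metric.ball x r) < ∞) : SigmaFinite μ := by
  rcases isEmpty_or_nonempty X with hX | ⟨⟨x⟩⟩
  · rw [Measure.eq_zero_of_isEmpty μ]
    infer_instance
  · exact ⟨⟨⟨fun n : ℕ => Metric.ball x (n + 1), fun _ => trivial,
      fun n => hfin x _ n.cast_add_one_pos, Metric.iUnion_ball_nat_succ x⟩⟩⟩

end Separability

section IntermediateValues

theorem IsNonatomicMeasure.nullSingletonClass {P : Type*} [MeasurableSpace P]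
    [MeasurableSingletonClass P] {μ : Measure P} (h : IsNonatomicMeasure μ) :
    NullSingletonClass μ := by
  refine ⟨fun x => by_contra fun hx => ?_⟩
  obtain ⟨B, hsub, -, hpos, hlt⟩ := h {x} (measurableSet_singleton x) (pos_iff_ne_zero.2 hx)
  rcases subset_singleton_iff_eq.1 hsub with rfl | rfl
  · exact hpos.ne' measure_empty
  · exact hlt.false

theorem continuous_measureReal_Iic (ν : Measure ℝ) [IsFiniteMeasure ν] [NullSingletonClass ν] :
    Continuous fun r => ν.real (Iic r) := by
  have hcont (a : ℝ) : ContinuousOn (fun r => ν.real (Iic r)) (Iic a) := by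
    simpa using IntegrableOn.continuousOn_Iic_primitive_Iic (μ := ν) (f := fun _ => (1 : ℝ))
      (integrable_const 1).integrableOn
  exact continuous_iff_continuousAt.2 fun r =>
    (hcont (r + 1)).continuousAt (Iic_mem_nhds (lt_add_one r))

theorem exists_measure_Iic_eq (ν : Measure ℝ) [IsFiniteMeasure ν] [NullSingletonClass ν]
    {a : ℝ≥0∞} (h0 : 0 < a) (ha : a < ν univ) : ∃ r, ν (Iic r) = a := by
  obtain ⟨r₁, hr₁⟩ : ∃ r, a < ν (Iic r) :=
    ((tendsto_measure_Iic_atTop ν).eventually (lt_mem_nhds ha)).exists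
  obtain ⟨r₀, hr₀⟩ : ∃ r, ν (Iic r) < a := by
    have hlim := tendsto_measure_iInter_atBot (μ := ν) (s := fun r : ℝ => Iic r)
      (fun r => measurableSet_Iic.nullMeasurableSet) (fun r s h => Iic_subset_Iic.2 h)
      ⟨0, measure_ne_top _ _⟩
    have hempty : ⋂ r : ℝ, Iic r = ∅ :=
      iInter_Iic_eq_empty_iff.2 (by simp [not_bddBelow_univ])
    rw [hempty, measure_empty] at hlim
    exact (hlim.eventually (gt_mem_nhds h0)).exists
  have hatop : a ≠ ∞ := (ha.trans (measure_lt_top ν univ)).ne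
  obtain ⟨r, hr⟩ := mem_range_of_exists_le_of_exists_ge (continuous_measureReal_Iic ν)
    ⟨r₀, ENNReal.toReal_mono hatop hr₀.le⟩ ⟨r₁, ENNReal.toReal_mono (measure_ne_top _ _) hr₁.le⟩
  exact ⟨r, (ENNReal.toReal_eq_toReal_iff' (measure_ne_top _ _) hatop).1 hr⟩

theorem exists_subset_measure_eq_of_isFiniteMeasure {α : Type*} [MeasurableSpace α]
    [MeasurableSpace.CountablySeparated α] (μ : Measure α) [IsFiniteMeasure μ]
    [NullSingletonClass μ] {a : ℝ≥0∞} (ha : a ≤ μ univ) : ∃ F, MeasurableSet F ∧ μ F = a := by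
  rcases eq_zero_or_pos a with rfl | h0
  · exact ⟨∅, .empty, measure_empty⟩
  rcases ha.eq_or_lt with rfl | ha
  · exact ⟨univ, .univ, rfl⟩
  obtain ⟨f, hf, hf_inj⟩ := MeasurableSpace.measurable_injection_nat_bool_of_countablySeparated α
  obtain ⟨e, he⟩ := exists_measurableEmbedding_real (ℕ → Bool)
  have hef : Measurable (e ∘ f) := he.measurable.comp hf
  have : NullSingletonClass (μ.map (e ∘ f)) := ⟨fun r => by
    rw [Measure.map_apply hef (measurableSet_singleton r)]
    exact (subsingleton_singleton.preimage (he.injective.comp hf_inj)).measure_zero μ⟩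
  obtain ⟨r, hr⟩ := exists_measure_Iic_eq (μ.map (e ∘ f)) h0
    (by rwa [Measure.map_apply hef .univ, preimage_univ])
  exact ⟨_, hef measurableSet_Iic, by rwa [Measure.map_apply hef measurableSet_Iic] at hr⟩

theorem exists_subset_measure_eq {α : Type*} [MeasurableSpace α]
    [MeasurableSpace.CountablySeparated α] (μ : Measure α) [SigmaFinite μ]
    [NullSingletonClass μ] {E : Set α} (hE : NullMeasurableSet E μ) {a : ℝ≥0∞} (ha : a ≤ μ E) :
    ∃ F ⊆ E, NullMeasurableSet F μ ∧ μ F = a := by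
  rcases ha.eq_or_lt with rfl | ha
  · exact ⟨E, Subset.rfl, hE, rfl⟩
  obtain ⟨n, hn⟩ : ∃ n, a < μ (E ∩ spanningSets μ n) := by
    rw [← inter_univ E, ← iUnion_spanningSets μ, inter_iUnion, Monotone.measure_iUnion
      fun m n h => inter_subset_inter_right _ (monotone_spanningSets μ h)] at ha
    exact lt_iSup_iff.1 ha
  have : Fact (μ (E ∩ spanningSets μ n) < ∞) :=
    ⟨(measure_mono inter_subset_right).trans_lt (measure_spanningSets_lt_top μ n)⟩
  obtain ⟨F, hF, hFa⟩ := exists_subset_measure_eq_of_isFiniteMeasure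
    (μ.restrict (E ∩ spanningSets μ n)) (hn.le.trans (by rw [Measure.restrict_apply_univ]))
  rw [Measure.restrict_apply hF] at hFa
  exact ⟨_, inter_subset_right.trans inter_subset_left,
    hF.nullMeasurableSet.inter (hE.inter (measurableSet_spanningSets μ n).nullMeasurableSet), hFa⟩

end IntermediateValues

section LayerCake

theorem lintegral_eq_lintegral_measure_ofReal_lt {α : Type*} [MeasurableSpace α] {μ : Measure α}
    {f : α → ℝ≥0∞} (hf : AEMeasurable f μ) :
    ∫⁻ x, f x ∂μ = ∫⁻ s in Ioi (0 : ℝ), μ {x | ENNReal.ofReal s < f x} := by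
  by_cases hfin : ∀ᵐ x ∂μ, f x < ∞
  · calc ∫⁻ x, f x ∂μ = ∫⁻ x, ENNReal.ofReal (f x).toReal ∂μ :=
          lintegral_congr_ae (hfin.mono fun x hx => (ENNReal.ofReal_toReal hx.ne).symm)
      _ = ∫⁻ s in Ioi (0 : ℝ), μ {x | s < (f x).toReal} :=
          lintegral_eq_lintegral_meas_lt μ (.of_forall fun x => ENNReal.toReal_nonneg)
            hf.ennreal_toReal
      _ = _ := setLIntegral_congr_fun measurableSet_Ioi fun s hs => measure_congr <| by
          filter_upwards [hfin] with x hx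
          exact propext (ENNReal.ofReal_lt_iff_lt_toReal hs.le hx.ne).symm
  · have htop : μ {x | f x = ∞} ≠ 0 := by simpa [ae_iff, not_lt, top_le_iff] using hfin
    rw [lintegral_eq_top_of_measure_eq_top_ne_zero hf htop, eq_comm, eq_top_iff]
    calc ∞ = ∫⁻ _ in Ioi (0 : ℝ), μ {x | f x = ∞} := by simp [htop]
      _ ≤ _ := lintegral_mono fun s => measure_mono fun x hx =>
          ENNReal.ofReal_lt_top.trans_eq (mem_ofPred_eq ▸ hx).symm

theorem lintegral_le_lintegral_of_measure_lt_le {α β : Type*} [MeasurableSpace α]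
    [MeasurableSpace β] {μ : Measure α} {ν : Measure β} {f : α → ℝ≥0∞} {g : β → ℝ≥0∞}
    (hf : AEMeasurable f μ) (hg : AEMeasurable g ν)
    (h : ∀ s, μ {x | s < f x} ≤ ν {y | s < g y}) : ∫⁻ x, f x ∂μ ≤ ∫⁻ y, g y ∂ν := by
  rw [lintegral_eq_lintegral_measure_ofReal_lt hf, lintegral_eq_lintegral_measure_ofReal_lt hg]
  exact lintegral_mono fun s => h _

end LayerCake

section MaximalFunction

variable {P : Type*} [MeasurableSpace P]

/-- The uncentred Hardy–Littlewood maximal function of `g : P → [0, ∞]`: the supremum of the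
averages of `g` over all open balls containing the given point. -/
noncomputable def maximalFun [PseudoMetricSpace P] (μ : Measure P) (g : P → ℝ≥0∞) (x : P) :
    ℝ≥0∞ :=
  ⨆ (y : P) (r : ℝ) (_ : 0 < r ∧ x ∈ Metric.ball y r), ⨍⁻ z in Metric.ball y r, g z ∂μ

theorem setOf_lt_maximalFun [PseudoMetricSpace P] (μ : Measure P) (g : P → ℝ≥0∞) (a : ℝ≥0∞) :
    {x | a < maximalFun μ g x} =
      ⋃ b ∈ {b : P × ℝ | 0 < b.2 ∧ a < ⨍⁻ z in Metric.ball b.1 b.2, g z ∂μ},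
        Metric.ball b.1 b.2 := by
  ext x
  simp only [maximalFun, lt_iSup_iff, mem_ofPred_eq, mem_iUnion, exists_prop, Prod.exists]
  exact exists₂_congr fun y r => by tauto

theorem measurable_maximalFun [PseudoMetricSpace P] [OpensMeasurableSpace P] (μ : Measure P)
    (g : P → ℝ≥0∞) : Measurable (maximalFun μ g) :=
  measurable_of_Ioi fun a => by
    have hopen : IsOpen {x | a < maximalFun μ g x} :=
      setOf_lt_maximalFun μ g a ▸ isOpen_biUnion fun _ _ => Metric.isOpen_ball
    exact hopen.measurableSet

theorem setLAverage_ball_le_maximalFun [PseudoMetricSpace P] (μ : Measure P) (g : P → ℝ≥0∞)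
    {y : P} {r : ℝ} (hr : 0 < r) {x : P} (hx : x ∈ Metric.ball y r) :
    ⨍⁻ z in Metric.ball y r, g z ∂μ ≤ maximalFun μ g x :=
  le_iSup₂_of_le y r (le_iSup_of_le ⟨hr, hx⟩ le_rfl)

theorem maximalFun_mono [PseudoMetricSpace P] {μ : Measure P} {f g : P → ℝ≥0∞} (h : f ≤ g)
    (x : P) : maximalFun μ f x ≤ maximalFun μ g x :=
  iSup₂_mono fun _ _ => iSup_mono fun _ => lintegral_mono h

theorem maximalFun_const_add_le [PseudoMetricSpace P] (μ : Measure P) (a : ℝ≥0∞)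
    (g : P → ℝ≥0∞) (x : P) : maximalFun μ (fun z => a + g z) x ≤ a + maximalFun μ g x := by
  refine iSup₂_le fun y r => iSup_le fun hx => ?_
  calc ⨍⁻ z in Metric.ball y r, (a + g z) ∂μ
      = a * μ (Metric.ball y r) / μ (Metric.ball y r) + ⨍⁻ z in Metric.ball y r, g z ∂μ := by
        rw [setLAverage_eq, setLAverage_eq, lintegral_add_left measurable_const,
          setLIntegral_const, ENNReal.add_div]
    _ ≤ a + maximalFun μ g x := add_le_add (ENNReal.div_le_of_le_mul le_rfl)
        (setLAverage_ball_le_maximalFun μ g hx.1 hx.2)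

theorem maximalFun_eq_zero [PseudoMetricSpace P] {μ : Measure P} {g : P → ℝ≥0∞}
    (h : ∫⁻ z, g z ∂μ = 0) (x : P) : maximalFun μ g x = 0 := by
  have hball (y : P) (r : ℝ) : ∫⁻ z in Metric.ball y r, g z ∂μ = 0 :=
    le_antisymm ((setLIntegral_le_lintegral _ _).trans h.le) zero_le
  simp [maximalFun, setLAverage_eq, hball]

theorem mul_measure_iUnion_ball_le [PseudoMetricSpace P] [SecondCountableTopology P]
    [OpensMeasurableSpace P] {μ : Measure P} {C : ℝ≥0}
    (hC : ∀ x r, 0 < r → μ (Metric.ball x (4 * r)) ≤ C * μ (Metric.ball x r)) {g : P → ℝ≥0∞}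
    {a : ℝ≥0∞} {R : ℝ} {t : Set (P × ℝ)}
    (ht : ∀ b ∈ t, 0 < b.2 ∧ b.2 ≤ R ∧ a < ⨍⁻ z in Metric.ball b.1 b.2, g z ∂μ) :
    a * μ (⋃ b ∈ t, Metric.ball b.1 b.2) ≤ C * ∫⁻ z, g z ∂μ := by
  obtain ⟨u, hut, hdisj, hcover⟩ := Vitali.exists_disjoint_subfamily_covering_enlargement_ball
    t Prod.fst Prod.snd R (fun b hb => (ht b hb).2.1) 4 (by norm_num)
  have hcount : u.Countable := hdisj.countable_of_isOpen (fun _ _ => Metric.isOpen_ball)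
    fun b hb => Metric.nonempty_ball.2 (ht b (hut hb)).1
  have hsub : ⋃ b ∈ t, Metric.ball b.1 b.2 ⊆ ⋃ b ∈ u, Metric.ball b.1 (4 * b.2) :=
    iUnion₂_subset fun b hb => by
      obtain ⟨b', hb', hsub⟩ := hcover b hb
      exact hsub.trans (subset_biUnion_of_mem (u := fun b : P × ℝ => Metric.ball b.1 (4 * b.2)) hb')
  calc a * μ (⋃ b ∈ t, Metric.ball b.1 b.2)
      ≤ a * ∑' b : u, μ (Metric.ball b.1.1 (4 * b.1.2)) := by
        gcongr
        exact (measure_mono hsub).trans (measure_biUnion_le μ hcount _)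
    _ ≤ a * ∑' b : u, C * μ (Metric.ball b.1.1 b.1.2) := by
        gcongr with b
        exact hC _ _ (ht b (hut b.2)).1
    _ = C * ∑' b : u, a * μ (Metric.ball b.1.1 b.1.2) := by
        rw [ENNReal.tsum_mul_left, ENNReal.tsum_mul_left, mul_left_comm]
    _ ≤ C * ∑' b : u, ∫⁻ z in Metric.ball b.1.1 b.1.2, g z ∂μ := by
        gcongr with b
        exact ENNReal.mul_le_of_le_div
          ((ht b (hut b.2)).2.2.le.trans_eq (setLAverage_eq _ _ _))
    _ = C * ∫⁻ z in ⋃ b ∈ u, Metric.ball b.1 b.2, g z ∂μ := by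
        rw [lintegral_biUnion hcount (fun _ _ => Metric.isOpen_ball.measurableSet) hdisj]
    _ ≤ C * ∫⁻ z, g z ∂μ := by
        gcongr
        exact Measure.restrict_le_self

theorem mul_measure_lt_maximalFun_le [PseudoMetricSpace P] [SecondCountableTopology P]
    [OpensMeasurableSpace P] {μ : Measure P} {C : ℝ≥0}
    (hC : ∀ x r, 0 < r → μ (Metric.ball x (4 * r)) ≤ C * μ (Metric.ball x r)) (g : P → ℝ≥0∞)
    (a : ℝ≥0∞) : a * μ {x | a < maximalFun μ g x} ≤ C * ∫⁻ z, g z ∂μ := by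
  let t (n : ℕ) : Set (P × ℝ) :=
    {b | 0 < b.2 ∧ b.2 ≤ n ∧ a < ⨍⁻ z in Metric.ball b.1 b.2, g z ∂μ}
  have hmono : Monotone fun n => ⋃ b ∈ t n, Metric.ball b.1 b.2 := fun m n h =>
    biUnion_subset_biUnion_left fun b hb => ⟨hb.1, hb.2.1.trans (Nat.cast_le.2 h), hb.2.2⟩
  have hsub : {x | a < maximalFun μ g x} ⊆ ⋃ n, ⋃ b ∈ t n, Metric.ball b.1 b.2 := by
    rw [setOf_lt_maximalFun]
    refine iUnion₂_subset fun b hb => ?_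
    obtain ⟨n, hn⟩ := exists_nat_ge b.2
    exact subset_iUnion_of_subset n
      (subset_biUnion_of_mem (u := fun b : P × ℝ => Metric.ball b.1 b.2) ⟨hb.1, hn, hb.2⟩)
  refine (mul_le_mul_right (measure_mono hsub) a).trans ?_
  rw [hmono.measure_iUnion, ENNReal.mul_iSup]
  exact iSup_le fun n => mul_measure_iUnion_ball_le hC fun b hb => hb

theorem measure_lt_maximalFun_le [PseudoMetricSpace P] [SecondCountableTopology P]
    [OpensMeasurableSpace P] {μ : Measure P} {C : ℝ≥0} (hC0 : 0 < C)
    (hC : ∀ x r, 0 < r → μ (Metric.ball x (4 * r)) ≤ C * μ (Metric.ball x r)) (g : P → ℝ≥0∞)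
    (a : ℝ≥0∞) : μ {x | a < maximalFun μ g x} ≤ (C * ∫⁻ z, g z ∂μ) / a := by
  rcases eq_or_ne a ∞ with rfl | ha
  · simp
  rcases eq_or_ne (∫⁻ z, g z ∂μ) 0 with hg | hg
  · simp [maximalFun_eq_zero hg]
  · rw [ENNReal.le_div_iff_mul_le (.inr (mul_ne_zero (ENNReal.coe_ne_zero.2 hC0.ne') hg)) (.inl ha),
      mul_comm]
    exact mul_measure_lt_maximalFun_le hC g a

theorem measure_add_lt_maximalFun_le [PseudoMetricSpace P] [SecondCountableTopology P]
    [OpensMeasurableSpace P] {μ : Measure P} {C : ℝ≥0} (hC0 : 0 < C)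
    (hC : ∀ x r, 0 < r → μ (Metric.ball x (4 * r)) ≤ C * μ (Metric.ball x r)) (g : P → ℝ≥0∞)
    (a s : ℝ≥0∞) :
    μ {x | a + s < maximalFun μ g x} ≤ (C * ∫⁻ z in {z | a < g z}, g z ∂μ) / s := by
  have hg : g ≤ fun z => a + {z | a < g z}.indicator g z := fun z => by
    by_cases hz : a < g z
    · simp [hz]
    · simpa only [indicator_of_notMem (show z ∉ {z | a < g z} from hz), add_zero] using not_lt.1 hz
  calc μ {x | a + s < maximalFun μ g x}
      ≤ μ {x | s < maximalFun μ ({z | a < g z}.indicator g) x} := measure_mono fun x hx =>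
        lt_of_add_lt_add_left
          (hx.trans_le ((maximalFun_mono hg x).trans (maximalFun_const_add_le μ a _ x)))
    _ ≤ (C * ∫⁻ z, {z | a < g z}.indicator g z ∂μ) / s := measure_lt_maximalFun_le hC0 hC _ s
    _ ≤ _ := by
        gcongr _ * ?_ / _
        exact lintegral_indicator_le _ _

theorem IsDoublingMeasure.exists_measure_ball_four_mul_le [MetricSpace P] {μ : Measure P}
    (h : IsDoublingMeasure μ) : ∃ C : ℝ≥0, 0 < C ∧
      ∀ x r, 0 < r → μ (Metric.ball x (4 * r)) ≤ C * μ (Metric.ball x r) := by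
  obtain ⟨c, hc1, hc⟩ := h
  refine ⟨c * c, by positivity, fun x r hr => ?_⟩
  calc μ (Metric.ball x (4 * r)) = μ (Metric.ball x (2 * (2 * r))) := by ring_nf
    _ ≤ c * (c * μ (Metric.ball x r)) := (hc _ _ (by positivity)).trans (by gcongr; exact hc x r hr)
    _ = _ := by rw [ENNReal.coe_mul, mul_assoc]

theorem maximalOp_eq [MetricSpace P] (μ : Measure P) {p : ℝ} (hp : 0 < p) (u : P → EReal)
    (x : P) :
    maximalOp μ p u x = ((maximalFun μ (fun z => (u z).abs ^ p) x ^ p⁻¹ : ℝ≥0∞) : EReal) := by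
  simp only [maximalOp, maximalFun, one_div, ← ENNReal.orderIsoRpow_apply p⁻¹ (inv_pos.2 hp),
    OrderIso.map_iSup]

end MaximalFunction

section Rearrangement

theorem measurable_ereal_abs : Measurable EReal.abs :=
  EReal.measurable_of_measurable_real (ENNReal.measurable_ofReal.comp measurable_norm)

theorem ereal_abs_coe_ennreal (c : ℝ≥0∞) : (c : EReal).abs = c := by
  induction c with
  | top => simp
  | coe c =>
    rw [show ((c : ℝ≥0∞) : EReal) = ((c : ℝ) : EReal) from rfl, EReal.abs_def,
      abs_of_nonneg c.coe_nonneg, ENNReal.ofReal_coe_nnreal]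

theorem abs_indicator_le {α : Type*} (E : Set α) (f : α → EReal) (x : α) :
    (E.indicator f x).abs ≤ (f x).abs := by
  by_cases hx : x ∈ E <;> simp [hx]

theorem setLAverage_Ioo_zero (f : ℝ → ℝ≥0∞) (t : ℝ) :
    ⨍⁻ s in Ioo 0 t, f s ∂volume = (∫⁻ s in Ioo 0 t, f s) / ENNReal.ofReal t := by
  rw [setLAverage_eq, Real.volume_Ioo, sub_zero]

theorem volume_restrict_Ioo_zero_setOf_ofReal_lt (t : ℝ) (m : ℝ≥0∞) :
    volume.restrict (Ioo 0 t) {s : ℝ | ENNReal.ofReal s < m} = min (ENNReal.ofReal t) m := by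
  rw [Measure.restrict_apply' measurableSet_Ioo]
  induction m with
  | top => simp
  | coe m =>
    have hlt {s : ℝ} (hs : 0 < s) : ENNReal.ofReal s < m ↔ s < m :=
      ENNReal.ofReal_lt_iff_lt_toReal hs.le ENNReal.coe_ne_top
    have hset : {s : ℝ | ENNReal.ofReal s < m} ∩ Ioo 0 t = Ioo 0 (min t m) := by
      ext s
      simp only [mem_inter_iff, mem_ofPred_eq, mem_Ioo, lt_min_iff]
      exact ⟨fun ⟨hm, h0, ht⟩ => ⟨h0, ht, (hlt h0).1 hm⟩,
        fun ⟨h0, ht, hm⟩ => ⟨(hlt h0).2 hm, h0, ht⟩⟩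
    rw [hset, Real.volume_Ioo, sub_zero, ENNReal.ofReal_min, ENNReal.ofReal_coe_nnreal]

variable {P : Type*} [MeasurableSpace P] {μ : Measure P}

theorem distribFun_antitone (f : P → EReal) : Antitone (distribFun μ f) :=
  fun _ _ h => measure_mono fun _ hx => h.trans_lt hx

theorem distribFun_decRearr_le (f : P → EReal) (t : ℝ) :
    distribFun μ f (decRearr μ f t) ≤ ENNReal.ofReal t := by
  have hne : {s | distribFun μ f s ≤ ENNReal.ofReal t}.Nonempty := ⟨∞, by simp [distribFun]⟩
  obtain ⟨v, hv, -, hlim, hmem⟩ := (isGLB_sInf _).exists_seq_antitone_tendsto hne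
  have hsub : {x | decRearr μ f t < (f x).abs} ⊆ ⋃ n, {x | v n < (f x).abs} := fun x hx =>
    mem_iUnion.2 (hlim.eventually (gt_mem_nhds hx)).exists
  have hmono : Monotone fun n => {x | v n < (f x).abs} := fun m n h x hx => (hv h).trans_lt hx
  refine (measure_mono hsub).trans ?_
  rw [hmono.measure_iUnion]
  exact iSup_le hmem

theorem decRearr_le_iff {f : P → EReal} {t : ℝ} {s : ℝ≥0∞} :
    decRearr μ f t ≤ s ↔ distribFun μ f s ≤ ENNReal.ofReal t :=
  ⟨fun h => (distribFun_antitone f h).trans (distribFun_decRearr_le f t), fun h => sInf_le h⟩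

theorem lt_decRearr_iff {f : P → EReal} {t : ℝ} {s : ℝ≥0∞} :
    s < decRearr μ f t ↔ ENNReal.ofReal t < distribFun μ f s := by
  rw [← not_le, ← not_le, decRearr_le_iff]

theorem le_decRearr {f : P → EReal} {t : ℝ} {s : ℝ≥0∞} {A : Set P}
    (hA : ENNReal.ofReal t < μ A) (h : ∀ x ∈ A, s ≤ (f x).abs) : s ≤ decRearr μ f t :=
  le_of_forall_lt fun _ hr =>
    lt_decRearr_iff.2 (hA.trans_le (measure_mono fun x hx => hr.trans_le (h x hx)))

theorem decRearr_antitone (f : P → EReal) : Antitone (decRearr μ f) := fun _ _ h =>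
  decRearr_le_iff.2 ((distribFun_decRearr_le f _).trans (ENNReal.ofReal_le_ofReal h))

theorem decRearr_indicator_le (E : Set P) (f : P → EReal) (t : ℝ) :
    decRearr μ (E.indicator f) t ≤ decRearr μ f t :=
  decRearr_le_iff.2 ((measure_mono fun x hx => hx.trans_le (abs_indicator_le E f x)).trans
    (distribFun_decRearr_le f t))

theorem decRearr_indicator_eq_zero {E : Set P} (f : P → EReal) {t : ℝ}
    (h : μ E ≤ ENNReal.ofReal t) : decRearr μ (E.indicator f) t = 0 := by
  refine nonpos_iff_eq_zero.1 (decRearr_le_iff.2 ((measure_mono fun x hx => ?_).trans h))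
  by_contra hE
  simp [hE] at hx

theorem decRearr_rpow_le_setLAverage (f : P → EReal) {p : ℝ} (hp : 0 ≤ p) {t : ℝ} (ht : 0 < t) :
    decRearr μ f t ^ p ≤ ⨍⁻ s in Ioo 0 t, decRearr μ f s ^ p ∂volume := by
  rw [setLAverage_Ioo_zero, ENNReal.le_div_iff_mul_le (.inl (ENNReal.ofReal_pos.2 ht).ne')
    (.inl ENNReal.ofReal_ne_top)]
  calc decRearr μ f t ^ p * ENNReal.ofReal t = ∫⁻ _ in Ioo 0 t, decRearr μ f t ^ p := by simp
    _ ≤ _ := setLIntegral_mono' measurableSet_Ioo fun s hs =>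
      ENNReal.rpow_le_rpow (decRearr_antitone f hs.2.le) hp

theorem setLIntegral_abs_rpow_le_setLIntegral_decRearr {f : P → EReal} (hf : AEMeasurable f μ)
    {p : ℝ} (hp : 0 < p) {D : Set P} {t : ℝ} (hD : μ D ≤ ENNReal.ofReal t) :
    ∫⁻ x in D, (f x).abs ^ p ∂μ ≤ ∫⁻ s in Ioo 0 t, decRearr μ f s ^ p := by
  refine lintegral_le_lintegral_of_measure_lt_le
    ((measurable_ereal_abs.comp_aemeasurable hf).restrict.pow_const p)
    ((decRearr_antitone f).measurable.pow_const p).aemeasurable fun s => ?_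
  simp only [← ENNReal.rpow_inv_lt_iff hp, lt_decRearr_iff]
  rw [volume_restrict_Ioo_zero_setOf_ofReal_lt]
  refine le_min ((measure_mono (subset_univ _)).trans ?_) (Measure.restrict_apply_le _ _)
  rwa [Measure.restrict_apply_univ]

theorem IsDoublingMeasure.exists_decRearr_maximalOp_rpow_le {P : Type*} [MetricSpace P]
    [SecondCountableTopology P] [MeasurableSpace P] [BorelSpace P] {μ : Measure P}
    (hdbl : IsDoublingMeasure μ) {p : ℝ} (hp : 0 < p) :
    ∃ C : ℝ≥0, ∀ u : P → EReal, AEMeasurable u μ → ∀ t, 0 < t →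
      decRearr μ (maximalOp μ p u) t ^ p ≤ C * ⨍⁻ s in Ioo 0 t, decRearr μ u s ^ p ∂volume := by
  obtain ⟨C, hC0, hC⟩ := hdbl.exists_measure_ball_four_mul_le
  refine ⟨1 + C, fun u hu t ht => ?_⟩
  set a := decRearr μ u t ^ p
  set J := ⨍⁻ s in Ioo 0 t, decRearr μ u s ^ p ∂volume with hJ
  have haJ : a ≤ J := decRearr_rpow_le_setLAverage u hp.le ht
  have hlevel : {z | a < (u z).abs ^ p} = {z | decRearr μ u t < (u z).abs} :=
    Set.ext fun z => ENNReal.rpow_lt_rpow_iff hp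
  have hint : ∫⁻ z in {z | a < (u z).abs ^ p}, (u z).abs ^ p ∂μ ≤ ENNReal.ofReal t * J := by
    rw [hJ, setLAverage_Ioo_zero, ENNReal.mul_div_cancel (ENNReal.ofReal_pos.2 ht).ne'
      ENNReal.ofReal_ne_top, hlevel]
    exact setLIntegral_abs_rpow_le_setLIntegral_decRearr hu hp (distribFun_decRearr_le u t)
  rw [← ENNReal.le_rpow_inv_iff hp, decRearr_le_iff]
  calc distribFun μ (maximalOp μ p u) (((1 + C : ℝ≥0) * J) ^ p⁻¹)
      ≤ μ {x | a + C * J < maximalFun μ (fun z => (u z).abs ^ p) x} :=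
        measure_mono fun x hx => by
          rw [mem_ofPred_eq, maximalOp_eq μ hp, ereal_abs_coe_ennreal,
            ENNReal.rpow_lt_rpow_iff (inv_pos.2 hp), ENNReal.coe_add, add_mul] at hx
          exact (add_le_add_left (by simpa using haJ) _).trans_lt hx
    _ ≤ (C * ∫⁻ z in {z | a < (u z).abs ^ p}, (u z).abs ^ p ∂μ) / (C * J) :=
        measure_add_lt_maximalFun_le hC0 hC _ _ _
    _ ≤ ENNReal.ofReal t := ENNReal.div_le_of_le_mul <| by
        rw [mul_left_comm]
        gcongr

end Rearrangement

section Sufficiency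

/-- The quantity `φ(t)^p (1/t) ∫_0^t φ(s)^{-p} ds`, which compares the mean of `φ^{-p}` over
`(0, t)` with its value at `t`. -/
noncomputable def powerMeanRatio (φ : ℝ → ℝ≥0∞) (p t : ℝ) : ℝ≥0∞ :=
  φ t ^ p * ⨍⁻ s in Ioo 0 t, φ s ^ (-p) ∂volume

variable {P : Type*} [MeasurableSpace P] {μ : Measure P} {φ : ℝ → ℝ≥0∞}

theorem decRearr_mul_le_weakMarcinkiewicz (μ : Measure P) (φ : ℝ → ℝ≥0∞) (u : P → EReal) {t : ℝ}
    (ht : 0 < t) : decRearr μ u t * φ t ≤ weakMarcinkiewicz μ φ u :=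
  le_iSup₂_of_le t ht le_rfl

theorem setLAverage_decRearr_rpow_le (hφ : Measurable φ) (hpos : ∀ t, 0 < t → 0 < φ t)
    (hfin : ∀ t, φ t < ∞) {p : ℝ} (hp : 0 ≤ p) (u : P → EReal) (t : ℝ) :
    ⨍⁻ s in Ioo 0 t, decRearr μ u s ^ p ∂volume ≤
      weakMarcinkiewicz μ φ u ^ p * ⨍⁻ s in Ioo 0 t, φ s ^ (-p) ∂volume := by
  rw [setLAverage_Ioo_zero, setLAverage_Ioo_zero, ← mul_div_assoc,
    ← lintegral_const_mul _ (hφ.pow_const _)]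
  gcongr ?_ / _
  refine setLIntegral_mono' measurableSet_Ioo fun s hs => ?_
  rw [ENNReal.rpow_neg, ← div_eq_mul_inv, ← ENNReal.div_rpow_of_nonneg _ _ hp]
  refine ENNReal.rpow_le_rpow ?_ hp
  rw [ENNReal.le_div_iff_mul_le (.inl (hpos s hs.1).ne') (.inl (hfin s).ne)]
  exact decRearr_mul_le_weakMarcinkiewicz μ φ u hs.1

theorem decRearr_mul_le_of_rpow_le_setLAverage (hφ : Measurable φ) (hpos : ∀ t, 0 < t → 0 < φ t)
    (hfin : ∀ t, φ t < ∞) {p : ℝ} (hp : 0 < p) {C : ℝ≥0∞} {u v : P → EReal} {t : ℝ}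
    (h : decRearr μ v t ^ p ≤ C * ⨍⁻ s in Ioo 0 t, decRearr μ u s ^ p ∂volume) :
    decRearr μ v t * φ t ≤ (C * powerMeanRatio φ p t) ^ p⁻¹ * weakMarcinkiewicz μ φ u := by
  have hpow : (decRearr μ v t * φ t) ^ p ≤
      C * powerMeanRatio φ p t * weakMarcinkiewicz μ φ u ^ p :=
    calc (decRearr μ v t * φ t) ^ p = decRearr μ v t ^ p * φ t ^ p :=
          ENNReal.mul_rpow_of_nonneg _ _ hp.le
      _ ≤ C * (weakMarcinkiewicz μ φ u ^ p * ⨍⁻ s in Ioo 0 t, φ s ^ (-p) ∂volume) * φ t ^ p := by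
          gcongr ?_ * _
          refine h.trans ?_
          gcongr
          exact setLAverage_decRearr_rpow_le hφ hpos hfin hp.le u t
      _ = _ := by rw [powerMeanRatio]; ring
  rwa [← ENNReal.le_rpow_inv_iff hp, ENNReal.mul_rpow_of_nonneg _ _ (inv_nonneg.2 hp.le),
    ENNReal.rpow_rpow_inv hp.ne'] at hpow

theorem weakMarcinkiewicz_indicator_le (hφ : Monotone φ) (hpos : ∀ t, 0 < t → 0 < φ t)
    (hfin : ∀ t, φ t < ∞) {v : P → EReal} {A : ℝ≥0∞}
    (h : ∀ t ∈ Ioo (0 : ℝ) 1, decRearr μ v t * φ t ≤ A) {E : Set P} (hE : μ E ≠ ∞) :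
    weakMarcinkiewicz μ φ (E.indicator v) ≤ (1 + φ (μ.real E) / φ (1 / 2)) * A := by
  refine iSup₂_le fun t ht => ?_
  rw [add_mul, one_mul]
  rcases lt_or_ge t 1 with ht1 | ht1
  · exact (mul_le_mul_left (decRearr_indicator_le E v t) _).trans
      ((h t ⟨ht, ht1⟩).trans le_self_add)
  rcases le_or_gt (μ E) (ENNReal.ofReal t) with htE | htE
  · simp [decRearr_indicator_eq_zero v htE]
  calc decRearr μ (E.indicator v) t * φ t ≤ decRearr μ v (1 / 2) * φ (μ.real E) :=
        mul_le_mul' ((decRearr_indicator_le E v t).trans (decRearr_antitone v (by linarith)))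
          (hφ ((ENNReal.ofReal_lt_iff_lt_toReal ht.le hE).1 htE).le)
    _ = φ (μ.real E) / φ (1 / 2) * (decRearr μ v (1 / 2) * φ (1 / 2)) := by
        rw [mul_left_comm, ENNReal.div_mul_cancel (hpos _ (by norm_num)).ne' (hfin _).ne]
    _ ≤ φ (μ.real E) / φ (1 / 2) * A := by gcongr; exact h _ (by norm_num)
    _ ≤ _ := le_add_self

theorem isBoundedFm_of_forall_indicator_le {NX NY : (P → EReal) → ℝ≥0∞}
    {T : (P → EReal) → P → EReal} (hT : ∀ u, AEMeasurable (T u) μ)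
    (h : ∀ E, NullMeasurableSet E μ → μ E < ∞ →
      ∃ c < ∞, ∀ u, MemSpace μ NX u → NY (E.indicator (T u)) ≤ c * NX u) :
    IsBoundedFm μ NX NY T := by
  refine ⟨fun u hu => ⟨hT u, fun E hE hEfin => ⟨(hT u).indicator₀ hE, ?_⟩⟩, fun E hE hEfin => ?_⟩
  · obtain ⟨c, hc, hle⟩ := h E hE hEfin
    exact (hle u hu).trans_lt (ENNReal.mul_lt_top hc hu.2)
  · obtain ⟨c, hc, hle⟩ := h E hE hEfin
    lift c to ℝ≥0 using hc.ne
    exact ⟨c + 1, by positivity, fun u hu => (hle u hu).trans (by gcongr; simp)⟩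

theorem measurable_maximalOp {P : Type*} [MetricSpace P] [MeasurableSpace P]
    [OpensMeasurableSpace P] (μ : Measure P) {p : ℝ} (hp : 0 < p) (u : P → EReal) :
    Measurable (maximalOp μ p u) := by
  simp only [funext (maximalOp_eq μ hp u)]
  exact ((measurable_maximalFun μ _).pow_const _).coe_ereal_ennreal

theorem isBoundedFm_maximalOp_of_iSup_powerMeanRatio_lt_top {P : Type*} [MetricSpace P]
    [SecondCountableTopology P] [MeasurableSpace P] [BorelSpace P] {μ : Measure P}
    (hdbl : IsDoublingMeasure μ) (hφ : Monotone φ) (hpos : ∀ t, 0 < t → 0 < φ t)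
    (hfin : ∀ t, φ t < ∞) {p : ℝ} (hp : 0 < p)
    (h : (⨆ (t : ℝ) (_ : t ∈ Ioo (0 : ℝ) 1), powerMeanRatio φ p t) < ∞) :
    IsBoundedFm μ (weakMarcinkiewicz μ φ) (weakMarcinkiewicz μ φ) (maximalOp μ p) := by
  obtain ⟨C, hC⟩ := hdbl.exists_decRearr_maximalOp_rpow_le hp
  set K := ⨆ (t : ℝ) (_ : t ∈ Ioo (0 : ℝ) 1), powerMeanRatio φ p t
  refine isBoundedFm_of_forall_indicator_le (fun u => (measurable_maximalOp μ hp u).aemeasurable)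
    fun E _ hE => ⟨(1 + φ (μ.real E) / φ (1 / 2)) * (C * K) ^ p⁻¹, ?_, fun u hu => ?_⟩
  · have hquot := ENNReal.div_lt_top (hfin (μ.real E)).ne (hpos (1 / 2) (by norm_num)).ne'
    exact ENNReal.mul_lt_top (ENNReal.add_lt_top.2 ⟨ENNReal.one_lt_top, hquot⟩)
      (ENNReal.rpow_lt_top_of_nonneg (inv_nonneg.2 hp.le)
        (ENNReal.mul_lt_top ENNReal.coe_lt_top h).ne)
  · rw [mul_assoc]
    refine weakMarcinkiewicz_indicator_le hφ hpos hfin (fun t ht => ?_) hE.ne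
    calc decRearr μ (maximalOp μ p u) t * φ t
        ≤ (C * powerMeanRatio φ p t) ^ p⁻¹ * weakMarcinkiewicz μ φ u :=
          decRearr_mul_le_of_rpow_le_setLAverage hφ.measurable hpos hfin hp (hC u hu.1 t ht.1)
      _ ≤ (C * K) ^ p⁻¹ * weakMarcinkiewicz μ φ u := by
          gcongr
          exact le_iSup₂_of_le t ht le_rfl

end Sufficiency

section Necessity

variable {P : Type*} [MeasurableSpace P] {μ : Measure P} {φ : ℝ → ℝ≥0∞} {B : ℕ → Set P}

/-- The smallest function that is at least `1 / φ(μ(B k))` on each set `B k`. For sets shrinking to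
a point its decreasing rearrangement is comparable to `1 / φ`, which makes it extremal in the unit
ball of `M^*_φ`. -/
noncomputable def stepFun (μ : Measure P) (φ : ℝ → ℝ≥0∞) (B : ℕ → Set P) (x : P) : ℝ≥0∞ :=
  ⨆ k, (B k).indicator (fun _ => (φ (μ.real (B k)))⁻¹) x

theorem setOf_lt_stepFun (μ : Measure P) (φ : ℝ → ℝ≥0∞) (B : ℕ → Set P) (s : ℝ≥0∞) :
    {x | s < stepFun μ φ B x} = ⋃ k ∈ {k | s < (φ (μ.real (B k)))⁻¹}, B k := by
  ext x
  simp only [stepFun, mem_ofPred_eq, lt_iSup_iff, mem_iUnion, exists_prop]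
  refine exists_congr fun k => ?_
  by_cases hx : x ∈ B k <;> simp [hx]

theorem measurable_stepFun (μ : Measure P) (φ : ℝ → ℝ≥0∞) (hB : ∀ k, MeasurableSet (B k)) :
    Measurable (stepFun μ φ B) :=
  .iSup fun k => measurable_const.indicator (hB k)

theorem weakMarcinkiewicz_stepFun_le_one (hφ : Monotone φ) (hB : Antitone B)
    (hfin : ∀ k, μ (B k) ≠ ∞) : weakMarcinkiewicz μ φ (fun x => (stepFun μ φ B x : EReal)) ≤ 1 := by
  refine iSup₂_le fun t _ => ?_
  have hlevel : distribFun μ (fun x => (stepFun μ φ B x : EReal)) (φ t)⁻¹ ≤ ENNReal.ofReal t := by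
    simp only [distribFun, ereal_abs_coe_ennreal]
    rw [setOf_lt_stepFun, measure_biUnion_eq_iSup (to_countable _) fun i hi j hj =>
      (le_total i j).elim (fun hij => ⟨i, hi, Subset.rfl, hB hij⟩)
        fun hji => ⟨j, hj, hB hji, Subset.rfl⟩]
    refine iSup₂_le fun k hk => ?_
    rw [← ENNReal.ofReal_toReal (hfin k)]
    exact ENNReal.ofReal_le_ofReal (hφ.reflect_lt (ENNReal.inv_lt_inv.1 hk)).le
  calc decRearr μ (fun x => (stepFun μ φ B x : EReal)) t * φ t ≤ (φ t)⁻¹ * φ t := by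
        gcongr
        exact decRearr_le_iff.2 hlevel
    _ ≤ 1 := ENNReal.inv_mul_le_one _

theorem exists_measure_succ_le_lt (hlim : Tendsto (fun k => μ (B k)) atTop (𝓝 0)) {j : ℕ}
    {a : ℝ≥0∞} (h0 : 0 < a) (ha : a < μ (B j)) : ∃ k ≥ j, μ (B (k + 1)) ≤ a ∧ a < μ (B k) := by
  have hex : ∃ i, μ (B (j + i)) ≤ a := by
    obtain ⟨k, hk, hjk⟩ := ((hlim.eventually (gt_mem_nhds h0)).and (eventually_ge_atTop j)).exists
    exact ⟨k - j, (Nat.add_sub_cancel' hjk).symm ▸ hk.le⟩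
  obtain ⟨i, hi, hi'⟩ := Nat.exists_not_and_succ_of_not_zero_of_exists
    (p := fun i => μ (B (j + i)) ≤ a) ha.not_ge hex
  exact ⟨j + i, Nat.le_add_right j i, hi', not_le.1 hi⟩

theorem volume_setOf_lt_inv_le_measure_setOf_lt_stepFun (hφ : Monotone φ) (hB : Antitone B)
    (hfin : ∀ k, μ (B k) ≠ ∞) {c : ℝ≥0} (hc : ∀ k, μ (B k) ≤ c * μ (B (k + 1)))
    (hlim : Tendsto (fun k => μ (B k)) atTop (𝓝 0)) (j : ℕ) (s : ℝ≥0∞) :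
    volume.restrict (Ioo 0 (μ.real (B j))) {t | s < (φ t)⁻¹} ≤
      c * μ.restrict (B j) {x | s < stepFun μ φ B x} := by
  set m := c * μ.restrict (B j) {x | s < stepFun μ φ B x}
  have hsub : ∀ t ∈ Ioo 0 (μ.real (B j)), s < (φ t)⁻¹ → ENNReal.ofReal t < m := by
    intro t ht hst
    obtain ⟨k, hjk, hk, hk'⟩ := exists_measure_succ_le_lt hlim (ENNReal.ofReal_pos.2 ht.1)
      ((ENNReal.ofReal_lt_iff_lt_toReal ht.1.le (hfin j)).2 ht.2)
    have hφk : φ (μ.real (B (k + 1))) ≤ φ t := hφ (ENNReal.toReal_le_of_le_ofReal ht.1.le hk)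
    have hBk : B (k + 1) ⊆ {x | s < stepFun μ φ B x} := by
      rw [setOf_lt_stepFun]
      exact subset_biUnion_of_mem (u := B) (hst.trans_le (ENNReal.inv_le_inv.2 hφk))
    calc ENNReal.ofReal t < μ (B k) := hk'
      _ ≤ c * μ (B (k + 1)) := hc k
      _ = c * μ.restrict (B j) (B (k + 1)) := by
          rw [Measure.restrict_eq_self _ (hB (hjk.trans k.le_succ))]
      _ ≤ m := mul_le_mul_right (measure_mono hBk) _
  calc volume.restrict (Ioo 0 (μ.real (B j))) {t | s < (φ t)⁻¹}
      ≤ volume.restrict (Ioo 0 (μ.real (B j))) {t | ENNReal.ofReal t < m} :=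
        measure_mono_ae ((ae_restrict_iff' measurableSet_Ioo).2 (.of_forall hsub))
    _ ≤ m := (volume_restrict_Ioo_zero_setOf_ofReal_lt _ _).trans_le (min_le_right _ _)

theorem setLIntegral_rpow_neg_le_setLIntegral_stepFun (hφ : Monotone φ) (hB : Antitone B)
    (hBm : ∀ k, MeasurableSet (B k)) (hfin : ∀ k, μ (B k) ≠ ∞) {c : ℝ≥0}
    (hc : ∀ k, μ (B k) ≤ c * μ (B (k + 1))) (hlim : Tendsto (fun k => μ (B k)) atTop (𝓝 0))
    {p : ℝ} (hp : 0 < p) (j : ℕ) :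
    ∫⁻ t in Ioo 0 (μ.real (B j)), φ t ^ (-p) ≤ c * ∫⁻ x in B j, stepFun μ φ B x ^ p ∂μ := by
  rw [← smul_eq_mul, ← lintegral_smul_measure]
  refine lintegral_le_lintegral_of_measure_lt_le (hφ.measurable.pow_const _).aemeasurable
    ((measurable_stepFun μ φ hBm).pow_const p).aemeasurable fun s => ?_
  simp only [ENNReal.rpow_neg, ← ENNReal.inv_rpow, ← ENNReal.rpow_inv_lt_iff hp]
  exact volume_setOf_lt_inv_le_measure_setOf_lt_stepFun hφ hB hfin hc hlim j _

theorem exists_powerMeanRatio_le_setLAverage_stepFun (hφ : Monotone φ) (hB : Antitone B)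
    (hBm : ∀ k, MeasurableSet (B k)) (hfin : ∀ k, μ (B k) ≠ ∞) {c : ℝ≥0}
    (hc : ∀ k, μ (B k) ≤ c * μ (B (k + 1))) (hlim : Tendsto (fun k => μ (B k)) atTop (𝓝 0))
    {p : ℝ} (hp : 0 < p) {t : ℝ} (ht : 0 < t) (htB : ENNReal.ofReal t < μ (B 0)) :
    ∃ j, ENNReal.ofReal t < μ (B j) ∧
      powerMeanRatio φ p t ≤ c ^ 2 * (φ t ^ p * ⨍⁻ x in B j, stepFun μ φ B x ^ p ∂μ) := by
  obtain ⟨j, -, hj, hj'⟩ := exists_measure_succ_le_lt hlim (ENNReal.ofReal_pos.2 ht) htB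
  have hinv : (ENNReal.ofReal t)⁻¹ ≤ c * (μ (B j))⁻¹ := by
    rw [← div_eq_mul_inv, ENNReal.le_div_iff_mul_le (.inl (hj'.trans_le' zero_le).ne')
      (.inl (hfin j)), mul_comm, ← div_eq_mul_inv]
    exact ENNReal.div_le_of_le_mul ((hc j).trans (by gcongr))
  have htj : Ioo 0 t ⊆ Ioo 0 (μ.real (B j)) :=
    Ioo_subset_Ioo_right ((ENNReal.ofReal_lt_iff_lt_toReal ht.le (hfin j)).1 hj').le
  refine ⟨j, hj', ?_⟩
  calc powerMeanRatio φ p t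
      = φ t ^ p * ((∫⁻ s in Ioo 0 t, φ s ^ (-p)) * (ENNReal.ofReal t)⁻¹) := by
        rw [powerMeanRatio, setLAverage_Ioo_zero, div_eq_mul_inv]
    _ ≤ φ t ^ p * ((c * ∫⁻ x in B j, stepFun μ φ B x ^ p ∂μ) * (c * (μ (B j))⁻¹)) := by
        gcongr
        exact (lintegral_mono_set htj).trans
          (setLIntegral_rpow_neg_le_setLIntegral_stepFun hφ hB hBm hfin hc hlim hp j)
    _ = _ := by
        rw [setLAverage_eq, div_eq_mul_inv]
        ring

theorem rpow_mul_setLAverage_ball_le {P : Type*} [MetricSpace P] [MeasurableSpace P]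
    {μ : Measure P} {p : ℝ} (hp : 0 < p) (u : P → EReal) {A : Set P} {y : P} {r : ℝ} (hr : 0 < r)
    (hA : Metric.ball y r ⊆ A) {t : ℝ} (ht : 0 < t)
    (htr : ENNReal.ofReal t < μ (Metric.ball y r)) :
    φ t ^ p * ⨍⁻ z in Metric.ball y r, (u z).abs ^ p ∂μ ≤
      weakMarcinkiewicz μ φ (A.indicator (maximalOp μ p u)) ^ p := by
  have hle : (⨍⁻ z in Metric.ball y r, (u z).abs ^ p ∂μ) ^ p⁻¹ ≤
      decRearr μ (A.indicator (maximalOp μ p u)) t := le_decRearr htr fun x hx => by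
    rw [indicator_of_mem (hA hx), maximalOp_eq μ hp, ereal_abs_coe_ennreal]
    exact ENNReal.rpow_le_rpow (setLAverage_ball_le_maximalFun μ _ hr hx) (inv_nonneg.2 hp.le)
  calc φ t ^ p * ⨍⁻ z in Metric.ball y r, (u z).abs ^ p ∂μ
      ≤ φ t ^ p * decRearr μ (A.indicator (maximalOp μ p u)) t ^ p := by
        gcongr
        exact (ENNReal.rpow_inv_le_iff hp).1 hle
    _ = (decRearr μ (A.indicator (maximalOp μ p u)) t * φ t) ^ p := by
        rw [mul_comm, ENNReal.mul_rpow_of_nonneg _ _ hp.le]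
    _ ≤ _ := ENNReal.rpow_le_rpow (decRearr_mul_le_weakMarcinkiewicz μ φ _ ht) hp.le

theorem setLIntegral_rpow_neg_lt_top (hφ : Monotone φ) (hpos : ∀ t, 0 < t → 0 < φ t) {p : ℝ}
    (hp : 0 < p) {r : ℝ} (hr : 0 < r) (h : powerMeanRatio φ p r < ∞) (T : ℝ) :
    ∫⁻ s in Ioo 0 T, φ s ^ (-p) < ∞ := by
  have hφr : φ r ^ p ≠ 0 := (ENNReal.rpow_pos_of_nonneg (hpos r hr) hp.le).ne'
  have hnear : ∫⁻ s in Ioo 0 r, φ s ^ (-p) < ∞ := by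
    by_contra! htop
    rw [powerMeanRatio, setLAverage_Ioo_zero, top_le_iff.1 htop,
      ENNReal.top_div_of_ne_top ENNReal.ofReal_ne_top, ENNReal.mul_top hφr] at h
    exact h.false
  have hsub : Ioo 0 T ⊆ Ioo 0 r ∪ Ico r T := fun s hs =>
    (lt_or_ge s r).imp (fun h => ⟨hs.1, h⟩) fun h => ⟨h, hs.2⟩
  calc ∫⁻ s in Ioo 0 T, φ s ^ (-p)
      ≤ (∫⁻ s in Ioo 0 r, φ s ^ (-p)) + ∫⁻ s in Ico r T, φ s ^ (-p) :=
        (lintegral_mono_set hsub).trans (lintegral_union_le _ _ _)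
    _ ≤ (∫⁻ s in Ioo 0 r, φ s ^ (-p)) + ∫⁻ _ in Ico r T, φ r ^ (-p) := by
        refine add_le_add le_rfl (setLIntegral_mono' measurableSet_Ico fun s hs => ?_)
        rw [ENNReal.rpow_neg, ENNReal.rpow_neg]
        exact ENNReal.inv_le_inv.2 (ENNReal.rpow_le_rpow (hφ hs.1) hp.le)
    _ < ∞ := by
        rw [setLIntegral_const, Real.volume_Ico, ENNReal.rpow_neg]
        exact ENNReal.add_lt_top.2
          ⟨hnear, ENNReal.mul_lt_top (ENNReal.inv_lt_top.2 hφr.bot_lt) ENNReal.ofReal_lt_top⟩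

theorem iSup_powerMeanRatio_lt_top (hφ : Monotone φ) (hpos : ∀ t, 0 < t → 0 < φ t)
    (hfin : ∀ t, φ t < ∞) {p : ℝ} (hp : 0 < p) {δ : ℝ} (hδ : 0 < δ) {Q : ℝ≥0∞} (hQ : Q < ∞)
    (h : ∀ t ∈ Ioo 0 δ, powerMeanRatio φ p t ≤ Q) (T : ℝ) :
    (⨆ (t : ℝ) (_ : t ∈ Ioo 0 T), powerMeanRatio φ p t) < ∞ := by
  have hint : ∫⁻ s in Ioo 0 T, φ s ^ (-p) < ∞ := setLIntegral_rpow_neg_lt_top hφ hpos hp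
    (half_pos hδ) ((h _ ⟨half_pos hδ, half_lt_self hδ⟩).trans_lt hQ) T
  have hfar : φ T ^ p * ((∫⁻ s in Ioo 0 T, φ s ^ (-p)) / ENNReal.ofReal δ) < ∞ :=
    ENNReal.mul_lt_top (ENNReal.rpow_lt_top_of_nonneg hp.le (hfin T).ne)
      (ENNReal.div_lt_top hint.ne (ENNReal.ofReal_pos.2 hδ).ne')
  refine (iSup₂_le fun t ht => ?_).trans_lt (max_lt hQ hfar)
  rcases lt_or_ge t δ with htδ | htδ
  · exact (h t ⟨ht.1, htδ⟩).trans (le_max_left _ _)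
  · refine le_max_of_le_right ?_
    rw [powerMeanRatio, setLAverage_Ioo_zero]
    gcongr
    exacts [hφ ht.2.le, ht.2.le]

theorem tendsto_measure_ball_nhdsGT_zero {X : Type*} [MetricSpace X] [MeasurableSpace X]
    [OpensMeasurableSpace X] {μ : Measure X} {x : X}
    (hfin : ∃ R > 0, μ (Metric.ball x R) ≠ ∞) :
    Tendsto (fun r => μ (Metric.ball x r)) (𝓝[>] 0) (𝓝 (μ {x})) := by
  simp only [← Metric.thickening_singleton] at hfin ⊢
  exact tendsto_measure_thickening_of_isClosed hfin isClosed_singleton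

theorem iSup_powerMeanRatio_lt_top_of_isBoundedFm_maximalOp {P : Type*} [MetricSpace P]
    [Nonempty P] [MeasurableSpace P] [OpensMeasurableSpace P] {μ : Measure P} [NullSingletonClass μ]
    (hball : ∀ (x : P) (r : ℝ), 0 < r → 0 < μ (Metric.ball x r) ∧ μ (Metric.ball x r) < ∞)
    (hdbl : IsDoublingMeasure μ) (hφ : Monotone φ) (hpos : ∀ t, 0 < t → 0 < φ t)
    (hfin : ∀ t, φ t < ∞) {p : ℝ} (hp : 0 < p)
    (h : IsBoundedFm μ (weakMarcinkiewicz μ φ) (weakMarcinkiewicz μ φ) (maximalOp μ p)) (T : ℝ) :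
    (⨆ (t : ℝ) (_ : t ∈ Ioo 0 T), powerMeanRatio φ p t) < ∞ := by
  obtain ⟨x⟩ := ‹Nonempty P›
  obtain ⟨c, -, hc⟩ := hdbl
  have hr (k : ℕ) : (0 : ℝ) < (1 / 2) ^ k := by positivity
  set B : ℕ → Set P := fun k => Metric.ball x ((1 / 2) ^ k) with hBdef
  have hBm (k : ℕ) : MeasurableSet (B k) := Metric.isOpen_ball.measurableSet
  have hB : Antitone B := fun m n hmn => Metric.ball_subset_ball
    (pow_le_pow_of_le_one (by norm_num) (by norm_num) hmn)
  have hBfin (k : ℕ) : μ (B k) ≠ ∞ := (hball x _ (hr k)).2.ne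
  have hBc (k : ℕ) : μ (B k) ≤ c * μ (B (k + 1)) := by
    simpa [hBdef, pow_succ, mul_comm, mul_assoc] using hc x _ (hr (k + 1))
  have hlim : Tendsto (fun k => μ (B k)) atTop (𝓝 0) := by
    rw [← measure_singleton (μ := μ) x]
    exact (tendsto_measure_ball_nhdsGT_zero ⟨1, one_pos, (hball x 1 one_pos).2.ne⟩).comp
      (tendsto_pow_atTop_nhdsWithin_zero_of_lt_one (by norm_num) (by norm_num))
  set w : P → EReal := fun z => (stepFun μ φ B z : EReal) with hw
  have hw1 : weakMarcinkiewicz μ φ w ≤ 1 := weakMarcinkiewicz_stepFun_le_one hφ hB hBfin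
  have hwm : AEMeasurable w μ := (measurable_stepFun μ φ hBm).coe_ereal_ennreal.aemeasurable
  obtain ⟨a, -, ha⟩ := h.2 (B 0) (hBm 0).nullMeasurableSet (hBfin 0).lt_top
  have haw : weakMarcinkiewicz μ φ ((B 0).indicator (maximalOp μ p w)) ≤ a :=
    (ha w ⟨hwm, hw1.trans_lt ENNReal.one_lt_top⟩).trans (mul_le_of_le_one_right' hw1)
  refine iSup_powerMeanRatio_lt_top hφ hpos hfin hp
    (ENNReal.toReal_pos (hball x _ (hr 0)).1.ne' (hBfin 0)) (Q := c ^ 2 * (a : ℝ≥0∞) ^ p)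
    (by finiteness) (fun t ht => ?_) T
  obtain ⟨j, htj, hj⟩ := exists_powerMeanRatio_le_setLAverage_stepFun hφ hB hBm hBfin hBc hlim hp
    ht.1 ((ENNReal.ofReal_lt_iff_lt_toReal ht.1.le (hBfin 0)).2 ht.2)
  have hball_est := rpow_mul_setLAverage_ball_le (φ := φ) hp w (hr j) (hB j.zero_le) ht.1 htj
  simp only [hw, ereal_abs_coe_ennreal] at hball_est
  calc powerMeanRatio φ p t ≤ c ^ 2 * (φ t ^ p * ⨍⁻ z in B j, stepFun μ φ B z ^ p ∂μ) := hj
    _ ≤ c ^ 2 * (a : ℝ≥0∞) ^ p := by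
        gcongr
        exact hball_est.trans (ENNReal.rpow_le_rpow haw hp.le)

end Necessity

section FundamentalFunction

variable {P : Type*} [MeasurableSpace P] {μ : Measure P} {N : (P → EReal) → ℝ≥0∞}

/-- A rearrangement-invariant gauge on measurable functions: a definite, monotone and
rearrangement-invariant functional that is finite on indicators of sets of finite measure. Neither
homogeneity, the triangle inequality nor the Fatou property is part of the notion, so that
rearrangement-invariant quasi-norms are included. -/
structure IsRIGauge (μ : Measure P) (N : (P → EReal) → ℝ≥0∞) : Prop where
  eq_zero_iff : ∀ u : P → EReal, AEMeasurable u μ → (N u = 0 ↔ ∀ᵐ x ∂μ, u x = 0)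
  lattice : ∀ u v : P → EReal, AEMeasurable u μ → AEMeasurable v μ →
    (∀ᵐ x ∂μ, (u x).abs ≤ (v x).abs) → N u ≤ N v
  indicator_lt_top : ∀ E : Set P, NullMeasurableSet E μ → μ E < ∞ →
    N (E.indicator fun _ => 1) < ∞
  rearr_inv : ∀ u v : P → EReal, AEMeasurable u μ → AEMeasurable v μ →
    (∀ t : ℝ≥0, distribFun μ u t = distribFun μ v t) → N u = N v

theorem IsRISpace.isRIGauge (hN : IsRISpace μ N) : IsRIGauge μ N :=
  ⟨hN.eq_zero_iff, hN.lattice, hN.indicator_lt_top, hN.rearr_inv⟩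

theorem aemeasurable_indicator_one_ereal {E : Set P} (hE : NullMeasurableSet E μ) :
    AEMeasurable (E.indicator fun _ => (1 : EReal)) μ :=
  aemeasurable_const.indicator₀ hE

theorem distribFun_indicator_one (μ : Measure P) (E : Set P) (s : ℝ≥0∞) :
    distribFun μ (E.indicator fun _ => 1) s = if s < 1 then μ E else 0 := by
  have habs_one : (1 : EReal).abs = 1 := by simpa using ereal_abs_coe_ennreal 1
  have hlevel : {x | s < (E.indicator (fun _ => (1 : EReal)) x).abs} =
      if s < 1 then E else ∅ := by
    ext x
    by_cases hx : x ∈ E <;> by_cases hs : s < 1 <;> simp [hx, hs, habs_one]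
  rw [distribFun, hlevel]
  split_ifs <;> simp

namespace IsRIGauge

theorem indicator_mono (hN : IsRIGauge μ N) {E F : Set P} (hE : NullMeasurableSet E μ)
    (hF : NullMeasurableSet F μ) (h : E ⊆ F) :
    N (E.indicator fun _ => 1) ≤ N (F.indicator fun _ => 1) := by
  refine hN.lattice _ _ (aemeasurable_indicator_one_ereal hE) (aemeasurable_indicator_one_ereal hF)
    (.of_forall fun x => ?_)
  rw [← inter_eq_left.2 h, ← indicator_indicator]
  exact abs_indicator_le E _ x

theorem indicator_congr (hN : IsRIGauge μ N) {E F : Set P} (hE : NullMeasurableSet E μ)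
    (hF : NullMeasurableSet F μ) (h : μ E = μ F) :
    N (E.indicator fun _ => 1) = N (F.indicator fun _ => 1) :=
  hN.rearr_inv _ _ (aemeasurable_indicator_one_ereal hE) (aemeasurable_indicator_one_ereal hF)
    fun s => by rw [distribFun_indicator_one, distribFun_indicator_one, h]

theorem fundFun_eq (hN : IsRIGauge μ N) {E : Set P} (hE : NullMeasurableSet E μ) {t : ℝ}
    (h : μ E = min (ENNReal.ofReal t) (μ univ)) : fundFun μ N t = N (E.indicator fun _ => 1) := by
  rw [fundFun]
  split_ifs with ht
  · rw [min_eq_left ht.le] at h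
    exact le_antisymm (iSup₂_le fun F hF => (hN.indicator_congr hF.1 hE (hF.2.trans h.symm)).le)
      (le_iSup₂_of_le E ⟨hE, h⟩ le_rfl)
  · rw [min_eq_right (not_lt.1 ht)] at h
    rw [hN.indicator_congr hE nullMeasurableSet_univ h, indicator_univ]

section Nonatomic

variable [MeasurableSpace.CountablySeparated P] [SigmaFinite μ] [NullSingletonClass μ]

theorem fundFun_mono (hN : IsRIGauge μ N) : Monotone (fundFun μ N) := fun s t hst => by
  obtain ⟨F, -, hF, hFt⟩ := exists_subset_measure_eq μ nullMeasurableSet_univ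
    (min_le_right (ENNReal.ofReal t) _)
  obtain ⟨E, hEF, hE, hEs⟩ := exists_subset_measure_eq μ hF
    (hFt.symm ▸ min_le_min_right (μ univ) (ENNReal.ofReal_le_ofReal hst))
  rw [hN.fundFun_eq hE hEs, hN.fundFun_eq hF hFt]
  exact hN.indicator_mono hE hF hEF

theorem fundFun_lt_top (hN : IsRIGauge μ N) (t : ℝ) : fundFun μ N t < ∞ := by
  obtain ⟨E, -, hE, hEt⟩ := exists_subset_measure_eq μ nullMeasurableSet_univ
    (min_le_right (ENNReal.ofReal t) _)
  rw [hN.fundFun_eq hE hEt]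
  exact hN.indicator_lt_top E hE (hEt.trans_lt (min_lt_of_left_lt ENNReal.ofReal_lt_top))

theorem fundFun_pos (hN : IsRIGauge μ N) [NeZero μ] {t : ℝ} (ht : 0 < t) : 0 < fundFun μ N t := by
  obtain ⟨E, -, hE, hEt⟩ := exists_subset_measure_eq μ nullMeasurableSet_univ
    (min_le_right (ENNReal.ofReal t) _)
  have hEpos : 0 < μ E := hEt ▸ lt_min (ENNReal.ofReal_pos.2 ht) (NeZero.pos _)
  rw [hN.fundFun_eq hE hEt, pos_iff_ne_zero, Ne,
    hN.eq_zero_iff _ (aemeasurable_indicator_one_ereal hE)]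
  intro hzero
  refine hEpos.ne' (measure_mono_null (fun x hx => ?_) (ae_iff.1 hzero))
  simp [hx]

end Nonatomic

theorem fundFun_eq_zero_of_isEmpty [IsEmpty P] (hN : IsRIGauge μ N) (t : ℝ) :
    fundFun μ N t = 0 := by
  rw [hN.fundFun_eq nullMeasurableSet_univ (t := t) (by simp [Measure.eq_zero_of_isEmpty μ])]
  exact (hN.eq_zero_iff _ (aemeasurable_indicator_one_ereal nullMeasurableSet_univ)).2
    (.of_forall fun x => isEmptyElim x)

end IsRIGauge

end FundamentalFunction

theorem isBoundedFm_weakMarcinkiewicz_maximalOp_iff {P : Type*} [MetricSpace P] [Nonempty P]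
    [SecondCountableTopology P] [MeasurableSpace P] [BorelSpace P] {μ : Measure P}
    [NullSingletonClass μ]
    (hball : ∀ (x : P) (r : ℝ), 0 < r → 0 < μ (Metric.ball x r) ∧ μ (Metric.ball x r) < ∞)
    (hdbl : IsDoublingMeasure μ) {φ : ℝ → ℝ≥0∞} (hφ : Monotone φ) (hpos : ∀ t, 0 < t → 0 < φ t)
    (hfin : ∀ t, φ t < ∞) {p : ℝ} (hp : 0 < p) :
    IsBoundedFm μ (weakMarcinkiewicz μ φ) (weakMarcinkiewicz μ φ) (maximalOp μ p) ↔
      (⨆ (t : ℝ) (_ : t ∈ Ioo (0 : ℝ) 1), powerMeanRatio φ p t) < ∞ :=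
  ⟨fun h => iSup_powerMeanRatio_lt_top_of_isBoundedFm_maximalOp hball hdbl hφ hpos hfin hp h 1,
    isBoundedFm_maximalOp_of_iSup_powerMeanRatio_lt_top hdbl hφ hpos hfin hp⟩

theorem mainTheorem10_general {P : Type*} [MetricSpace P] [MeasurableSpace P] [BorelSpace P]
    (μ : Measure P)
    (hball : ∀ (x : P) (r : ℝ), 0 < r → 0 < μ (Metric.ball x r) ∧ μ (Metric.ball x r) < ∞)
    (hdbl : IsDoublingMeasure μ) (hna : IsNonatomicMeasure μ)
    (N : (P → EReal) → ℝ≥0∞) (hN : IsRIGauge μ N) (p : ℝ) (hp : 0 < p) :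
    IsBoundedFm μ (weakNorm μ N) (weakNorm μ N) (maximalOp μ p) ↔
      (⨆ (t : ℝ) (_ : t ∈ Ioo (0 : ℝ) 1),
        fundFun μ N t ^ p * (⨍⁻ s in Ioo (0 : ℝ) t, fundFun μ N s ^ (-p) ∂volume)) < ∞ := by
  have := hna.nullSingletonClass
  have := isOpenPosMeasure_of_measure_ball_pos fun x r hr => (hball x r hr).1
  have := sigmaFinite_of_measure_ball_lt_top fun x r hr => (hball x r hr).2
  have := secondCountableTopology_of_isOpenPosMeasure μ
  rcases isEmpty_or_nonempty P with _ | _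
  · have hφ := hN.fundFun_eq_zero_of_isEmpty
    refine iff_of_true (isBoundedFm_of_forall_indicator_le
      (fun u => (measurable_maximalOp μ hp u).aemeasurable)
      fun E _ _ => ⟨0, ENNReal.zero_lt_top, fun u _ => ?_⟩) ?_
    · simp [weakNorm, weakMarcinkiewicz, hφ]
    · simp [hφ, hp]
  · exact isBoundedFm_weakMarcinkiewicz_maximalOp_iff hball hdbl hN.fundFun_mono
      (fun _ => hN.fundFun_pos) hN.fundFun_lt_top hp

theorem mainTheorem10 {P : Type*} [MetricSpace P] [MeasurableSpace P] [BorelSpace P]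
    (μ : Measure P)
    (hball : ∀ (x : P) (r : ℝ), 0 < r → 0 < μ (Metric.ball x r) ∧ μ (Metric.ball x r) < ∞)
    (hdbl : IsDoublingMeasure μ) (hna : IsNonatomicMeasure μ)
    (N : (P → EReal) → ℝ≥0∞) (hN : IsRISpace μ N) (p : ℝ) (hp : 1 ≤ p) :
    IsBoundedFm μ (weakNorm μ N) (weakNorm μ N) (maximalOp μ p) ↔
      (⨆ (t : ℝ) (_ : t ∈ Ioo (0 : ℝ) 1),
        fundFun μ N t ^ p * (⨍⁻ s in Ioo (0 : ℝ) t, fundFun μ N s ^ (-p) ∂volume)) < ∞ :=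
  mainTheorem10_general μ hball hdbl hna N hN.isRIGauge p (zero_lt_one.trans_le hp)
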